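/- Let $m \ge 2$ be an integer and let $\omega_m = e^{2\pi i/m}$. Then the value of the Riemann zeta function at $m$ is $$\zeta(m) = \sum_{n=1}^{\infty} \frac{m\,(-1)^{n-1}\,\prod_{j=1}^{m-1}\Gamma\bigl(1-\omega_m^{\,j}\, n\bigr)}{n!\; n^m},$$ where $\Gamma$ is the complex Gamma function and the series converges absolutely. -/

import Mathlib

/-! Expand `∏_{k≤K} 1/(1 - w/k^m)` in partial fractions with coefficients `c(K,n)`. The coefficient
of `w` gives `∑ c(K,n)/n^m = ∑_{k≤K} 1/k^m`, which tends to `ζ(m)`. Splitting `k^m - n^m` over the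
`m`-th roots of unity turns `c(K,n)` into a product of Euler's truncated Gamma products, so it
converges as `K → ∞` to the Gamma expression. Since `|c(K,n)| ≤ 2` uniformly, dominated convergence
moves the limit inside the sum. -/

/-! ### Partial fractions and power sums -/

open Finset in
/-- The coefficient of `1 / (1 - w / (n+1)^m)` in the partial fraction expansion of
`∏_{k=1}^K 1 / (1 - w / k^m)`. -/
noncomputable def partialFractionCoeff (m K n : ℕ) : ℝ :=
  ∏ k ∈ (Finset.range K).erase n, ((k : ℝ) + 1) ^ m / (((k : ℝ) + 1) ^ m - ((n : ℝ) + 1) ^ m)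

-- The polynomial `X^N - ∏(X - v i)`, with `N = #s`, has degree below `N`, equals `v i ^ N` at the
-- nodes, and has `X^(N-1)`-coefficient `∑ v i`; Lagrange interpolation reads off that coefficient.
open Finset Polynomial in
theorem sum_pow_card_div_prod_sub {F ι : Type*} [Field F] [DecidableEq ι] (s : Finset ι)
    (v : ι → F) (hv : Set.InjOn v s) :
    ∑ i ∈ s, v i ^ #s / ∏ j ∈ s.erase i, (v i - v j) = ∑ i ∈ s, v i := by
  rcases s.eq_empty_or_nonempty with rfl | hs
  · simp
  have hcard : 0 < #s := hs.card_pos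
  have hdeg : (X ^ #s - Lagrange.nodal s v : F[X]).degree < #s := by
    have h := degree_sub_lt_left (p := (X ^ #s : F[X])) (q := Lagrange.nodal s v)
      (by rw [Lagrange.degree_nodal, degree_X_pow]) (pow_ne_zero _ X_ne_zero)
      (by rw [(Lagrange.nodal_monic).leadingCoeff, leadingCoeff_X_pow])
    rwa [degree_X_pow] at h
  have h := Lagrange.coeff_eq_sum hv hdeg
  rw [coeff_sub, coeff_X_pow, if_neg (by omega), Lagrange.nodal_eq,
    prod_X_sub_C_coeff_card_pred s v hcard] at h
  rw [zero_sub, neg_neg] at h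
  rw [h]
  refine Finset.sum_congr rfl fun i hi => ?_
  rw [eval_sub, ← Lagrange.nodal_eq, Lagrange.eval_nodal_at_node hi]
  simp

theorem succ_pow_injective {m : ℕ} (hm : m ≠ 0) {k n : ℕ}
    (h : ((k : ℝ) + 1) ^ m = ((n : ℝ) + 1) ^ m) : k = n := by
  have := (pow_left_inj₀ (by positivity) (by positivity) hm).1 h
  exact_mod_cast add_right_cancel this

open Finset in
theorem sum_partialFractionCoeff_div {m : ℕ} (hm : m ≠ 0) (K : ℕ) :
    ∑ n ∈ range K, partialFractionCoeff m K n / ((n : ℝ) + 1) ^ m =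
      ∑ n ∈ range K, 1 / ((n : ℝ) + 1) ^ m := by
  have hinj : Set.InjOn (fun n : ℕ => 1 / ((n : ℝ) + 1) ^ m) (range K) := by
    intro a _ b _ hab
    simp only [one_div, inv_inj] at hab
    exact succ_pow_injective hm hab
  rw [← sum_pow_card_div_prod_sub (range K) _ hinj]
  refine sum_congr rfl fun n hn => ?_
  have hK : #(range K) = #((range K).erase n) + 1 := (card_erase_add_one hn).symm
  rw [hK, pow_succ, mul_div_right_comm, ← prod_const, ← prod_div_distrib, partialFractionCoeff,
    mul_one_div]
  congr 1
  refine prod_congr rfl fun k hk => ?_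
  have hne : ((k : ℝ) + 1) ^ m - ((n : ℝ) + 1) ^ m ≠ 0 :=
    sub_ne_zero.2 fun h => (ne_of_mem_erase hk) (succ_pow_injective hm h)
  have h1 : ((k : ℝ) + 1) ^ m ≠ 0 := by positivity
  have h2 : ((n : ℝ) + 1) ^ m ≠ 0 := by positivity
  generalize ((k : ℝ) + 1) ^ m = a at *
  generalize ((n : ℝ) + 1) ^ m = b at *
  have : 1 / b - 1 / a ≠ 0 := by
    rw [div_sub_div _ _ h2 h1, one_mul, mul_one]
    exact div_ne_zero hne (mul_ne_zero h2 h1)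
  rw [div_eq_div_iff hne this]
  field_simp

/-! ### Factorial products and the uniform bound -/

open Finset Nat in
theorem prod_erase_range_natCast_sub {R : Type*} [CommRing R] (n r : ℕ) :
    ∏ k ∈ (range (n + 1 + r)).erase n, ((k : R) - n) = (-1) ^ n * n ! * r ! := by
  induction r with
  | zero =>
    have : (range (n + 1 + 0)).erase n = range n := by
      ext k; simp only [mem_erase, mem_range]; omega
    rw [this, ← prod_range_reflect, ← prod_range_add_one_eq_factorial]
    simp only [factorial_zero, cast_one, mul_one, cast_prod]
    rw [← card_range n, ← prod_const, card_range, ← prod_mul_distrib]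
    refine prod_congr rfl fun k hk => ?_
    have hk' : k + 1 ≤ n := mem_range.1 hk
    rw [Nat.sub_sub, Nat.cast_sub (by omega)]
    push_cast
    ring
  | succ r ih =>
    have : (range (n + 1 + (r + 1))).erase n =
        insert (n + 1 + r) ((range (n + 1 + r)).erase n) := by
      ext k; simp only [mem_erase, mem_range, mem_insert]; omega
    rw [this, prod_insert (by simp), ih, factorial_succ]
    push_cast
    ring

open Finset Nat in
theorem two_mul_prod_erase_range_add (n r : ℕ) :
    2 * (∏ k ∈ (range (n + 1 + r)).erase n, ((k : ℝ) + n + 2)) * (n + 1) * (n + 1)! =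
      (2 * n + 2 + r)! := by
  have h1 := mul_prod_erase (range (n + 1 + r)) (fun k : ℕ => (k : ℝ) + n + 2)
    (a := n) (by simp; omega)
  have h2 := Nat.factorial_mul_ascFactorial (n + 1) (n + 1 + r)
  rw [ascFactorial_eq_prod_range] at h2
  have h3 : n + 1 + (n + 1 + r) = 2 * n + 2 + r := by ring
  rw [h3] at h2
  rw [← h2]
  push_cast
  have h4 : ∏ k ∈ range (n + 1 + r), ((n : ℝ) + 1 + 1 + k) =
      ∏ k ∈ range (n + 1 + r), ((k : ℝ) + n + 2) := prod_congr rfl fun k _ => by ring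
  rw [h4, ← h1]
  ring

open Finset Nat in
theorem prod_erase_range_succ (n r : ℕ) {R : Type*} [CommRing R] :
    ((n : R) + 1) * ∏ k ∈ (range (n + 1 + r)).erase n, ((k : R) + 1) = (n + 1 + r)! := by
  rw [mul_prod_erase (range (n + 1 + r)) (fun k : ℕ => (k : R) + 1) (by simp; omega),
    ← prod_range_add_one_eq_factorial]
  push_cast
  rfl

-- With `K = n + 1 + r`, the absolute value is exactly `2 * C(2K, r) / C(2K, K)`, and the central
-- binomial coefficient is the largest.
open Finset Nat in
theorem abs_partialFractionCoeff_two_le (n r : ℕ) :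
    |partialFractionCoeff 2 (n + 1 + r) n| ≤ 2 := by
  have h1 := prod_erase_range_natCast_sub (R := ℝ) n r
  have h2 := two_mul_prod_erase_range_add n r
  have h3 := prod_erase_range_succ n r (R := ℝ)
  have h4 : ∏ k ∈ (range (n + 1 + r)).erase n, (((k : ℝ) + 1) ^ 2 - ((n : ℝ) + 1) ^ 2) =
      (∏ k ∈ (range (n + 1 + r)).erase n, ((k : ℝ) - n)) *
        ∏ k ∈ (range (n + 1 + r)).erase n, ((k : ℝ) + n + 2) := by
    rw [← prod_mul_distrib]
    exact prod_congr rfl fun k _ => by ring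
  have h5 : (n + 1 + r)! * (n + 1 + r)! ≤ r ! * (2 * n + 2 + r)! := by
    have hc := choose_le_centralBinom r (n + 1 + r)
    have e1 := Nat.choose_mul_factorial_mul_factorial (n := 2 * (n + 1 + r)) (k := r) (by omega)
    have e2 := Nat.choose_mul_factorial_mul_factorial (n := 2 * (n + 1 + r)) (k := n + 1 + r)
      (by omega)
    rw [show 2 * (n + 1 + r) - r = 2 * n + 2 + r by omega] at e1
    rw [show 2 * (n + 1 + r) - (n + 1 + r) = n + 1 + r by omega] at e2
    rw [centralBinom] at hc
    rw [← e1, mul_assoc, mul_assoc] at e2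
    have hpos : 0 < (2 * (n + 1 + r)).choose r := choose_pos (by omega)
    refine le_of_mul_le_mul_left ?_ hpos
    rw [← e2]
    exact Nat.mul_le_mul_right _ hc
  rw [partialFractionCoeff, prod_div_distrib, h4, h1, prod_pow, abs_div, abs_mul, abs_mul, abs_mul,
    abs_pow, abs_pow, abs_neg, abs_one, one_pow, one_mul]
  set A := ∏ k ∈ (range (n + 1 + r)).erase n, ((k : ℝ) + n + 2) with hA
  set B := ∏ k ∈ (range (n + 1 + r)).erase n, ((k : ℝ) + 1) with hB
  have hApos : 0 < A := prod_pos fun k _ => by positivity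
  have hBpos : 0 < B := prod_pos fun k _ => by positivity
  rw [abs_of_pos hApos, abs_of_pos hBpos, Nat.abs_cast, Nat.abs_cast, div_le_iff₀ (by positivity)]
  have h6 : ((n + 1 + r)! : ℝ) * (n + 1 + r)! ≤ r ! * (2 * n + 2 + r)! := by exact_mod_cast h5
  rw [← h2, ← h3, factorial_succ] at h6
  push_cast at h6
  have hn : 0 < ((n : ℝ) + 1) ^ 2 := by positivity
  refine le_of_mul_le_mul_left ?_ hn
  linarith

open Finset in
theorem abs_partialFractionCoeff_le {m : ℕ} (hm : 2 ≤ m) {K n : ℕ} (hn : n < K) :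
    |partialFractionCoeff m K n| ≤ 2 := by
  obtain ⟨r, rfl⟩ : ∃ r, K = n + 1 + r := ⟨K - (n + 1), by omega⟩
  refine le_trans ?_ (abs_partialFractionCoeff_two_le n r)
  rw [partialFractionCoeff, partialFractionCoeff, abs_prod, abs_prod]
  refine prod_le_prod (fun _ _ => abs_nonneg _) fun k hk => ?_
  have hne (j : ℕ) (hj : j ≠ 0) : (1 : ℝ) - (((n : ℝ) + 1) / (k + 1)) ^ j ≠ 0 := by
    rw [div_pow]
    intro h
    have hpos : ((k : ℝ) + 1) ^ j ≠ 0 := by positivity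
    rw [sub_eq_zero, eq_div_iff hpos, one_mul] at h
    exact ne_of_mem_erase hk (succ_pow_injective hj h)
  have hform (j : ℕ) : |((k : ℝ) + 1) ^ j / (((k : ℝ) + 1) ^ j - ((n : ℝ) + 1) ^ j)| =
      |(1 : ℝ) - (((n : ℝ) + 1) / (k + 1)) ^ j|⁻¹ := by
    rw [← abs_inv, div_pow]
    congr 1
    have hpos : ((k : ℝ) + 1) ^ j ≠ 0 := by positivity
    rw [one_sub_div hpos, inv_div]
  rw [hform, hform]
  -- For `x ≥ 0`, `|1 - x^m|` grows with `m`, so `m = 2` is the worst case.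
  refine inv_anti₀ (abs_pos.2 (hne 2 two_ne_zero)) ?_
  have hx : 0 ≤ ((n : ℝ) + 1) / (k + 1) := by positivity
  generalize ((n : ℝ) + 1) / (k + 1) = x at *
  rcases le_total x 1 with h | h
  · rw [abs_of_nonneg (sub_nonneg.2 (pow_le_one₀ hx h)),
      abs_of_nonneg (sub_nonneg.2 (pow_le_one₀ hx h))]
    have := pow_le_pow_of_le_one hx h hm
    linarith
  · rw [abs_of_nonpos (sub_nonpos.2 (one_le_pow₀ h)),
      abs_of_nonpos (sub_nonpos.2 (one_le_pow₀ h))]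
    have := pow_le_pow_right₀ h hm
    linarith

/-! ### Roots of unity and truncated Gamma products -/

open Finset in
theorem IsPrimitiveRoot.sub_mul_prod_sub_pow_succ_mul {R : Type*} [CommRing R] [IsDomain R]
    {M : ℕ} {ζ : R} (hζ : IsPrimitiveRoot ζ (M + 1)) (x y : R) :
    (x - y) * ∏ j ∈ range M, (x - ζ ^ (j + 1) * y) = x ^ (M + 1) - y ^ (M + 1) := by
  have h := congrArg (Polynomial.eval x) (X_pow_sub_C_eq_prod hζ M.succ_pos (α := y) rfl)
  rw [Polynomial.eval_prod, prod_range_succ'] at h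
  simp only [Polynomial.eval_sub, Polynomial.eval_pow, Polynomial.eval_X, Polynomial.eval_C,
    pow_zero, one_mul] at h
  rw [h, mul_comm]

open Finset in
theorem IsPrimitiveRoot.prod_self_sub_pow_succ_mul {R : Type*} [CommRing R] [IsDomain R]
    {M : ℕ} {ζ : R} (hζ : IsPrimitiveRoot ζ (M + 1)) (y : R) :
    ∏ j ∈ range M, (y - ζ ^ (j + 1) * y) = (M + 1) * y ^ M := by
  have h : ∏ j ∈ range M, (y - ζ ^ (j + 1) * y) = ∏ j ∈ range M, (1 - ζ ^ (j + 1)) * y :=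
    prod_congr rfl fun j _ => by ring
  rw [h, prod_mul_distrib, hζ.prod_one_sub_pow_eq_order, prod_const, card_range]

-- The nontrivial roots sum to `-1`. This makes the total exponent of the complex powers in the
-- `GammaSeq` product a natural number.
open Finset in
theorem IsPrimitiveRoot.sum_one_sub_pow_succ_mul {R : Type*} [CommRing R] [IsDomain R]
    {M : ℕ} {ζ : R} (hζ : IsPrimitiveRoot ζ (M + 1)) (hM : M ≠ 0) (y : R) :
    ∑ j ∈ range M, (1 - ζ ^ (j + 1) * y) = M + y := by
  have h := hζ.geom_sum_eq_zero (by omega)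
  rw [sum_range_succ', pow_zero] at h
  rw [sum_sub_distrib, ← sum_mul, eq_neg_of_add_eq_zero_left h]
  simp

open Finset in
theorem Complex.prod_cpow_eq_cpow_sum {ι : Type*} (s : Finset ι) (f : ι → ℂ) {x : ℂ}
    (hx : x ≠ 0) : ∏ i ∈ s, x ^ f i = x ^ ∑ i ∈ s, f i := by
  simp only [cpow_def_of_ne_zero hx, ← exp_sum, mul_sum]

open Finset Nat in
theorem prod_GammaSeq_one_sub_pow_succ_mul {M : ℕ} (hM : M ≠ 0) {ζ : ℂ}
    (hζ : IsPrimitiveRoot ζ (M + 1)) (n r : ℕ) (hr : n + r ≠ 0) :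
    ∏ j ∈ range M, Complex.GammaSeq (1 - ζ ^ (j + 1) * ((n + 1 : ℕ) : ℂ)) (n + r) =
      ((n + r : ℕ) : ℂ) ^ (M + (n + 1)) * (n + r)! ^ M / ((M + 1) * ((n : ℂ) + 1) ^ M *
        ∏ k ∈ (range (n + 1 + r)).erase n,
          (((k : ℂ) + 1) ^ (M + 1) - ((n : ℂ) + 1) ^ (M + 1)) / ((k : ℂ) - n)) := by
  have hcpow : ∏ j ∈ range M, ((n + r : ℕ) : ℂ) ^ (1 - ζ ^ (j + 1) * ((n + 1 : ℕ) : ℂ)) =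
      ((n + r : ℕ) : ℂ) ^ (M + (n + 1)) := by
    rw [Complex.prod_cpow_eq_cpow_sum _ _ (by exact_mod_cast hr),
      hζ.sum_one_sub_pow_succ_mul hM, ← Complex.cpow_natCast]
    push_cast
    rfl
  have hden : ∏ j ∈ range M, ∏ k ∈ range (n + r + 1), (1 - ζ ^ (j + 1) * ((n + 1 : ℕ) : ℂ) + k) =
      (M + 1) * ((n : ℂ) + 1) ^ M * ∏ k ∈ (range (n + 1 + r)).erase n,
          (((k : ℂ) + 1) ^ (M + 1) - ((n : ℂ) + 1) ^ (M + 1)) / ((k : ℂ) - n) := by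
    -- The factor `k = n` is split off because there `x^m - y^m` and `x - y` both vanish.
    rw [prod_comm, show n + r + 1 = n + 1 + r by ring,
      ← mul_prod_erase (range (n + 1 + r)) _ (a := n) (by simp; omega),
      ← hζ.prod_self_sub_pow_succ_mul]
    congr 1
    · exact prod_congr rfl fun j _ => by push_cast; ring
    · refine prod_congr rfl fun k hk => ?_
      have hne : (k : ℂ) - n ≠ 0 := sub_ne_zero.2 (by exact_mod_cast ne_of_mem_erase hk)
      rw [eq_div_iff hne, ← hζ.sub_mul_prod_sub_pow_succ_mul, mul_comm]
      congr 1
      · ring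
      · exact prod_congr rfl fun j _ => by push_cast; ring
  simp only [Complex.GammaSeq]
  rw [prod_div_distrib, prod_mul_distrib, hcpow, hden, prod_const, card_range]

-- `GammaSeq` at `N` has `N + 1` denominator factors, hence `N = n + r = K - 1`. The last bracket is
-- a correction tending to `1`.
open Finset Nat in
theorem partialFractionCoeff_eq_prod_GammaSeq {M : ℕ} (hM : M ≠ 0) {ζ : ℂ}
    (hζ : IsPrimitiveRoot ζ (M + 1)) (n r : ℕ) (hr : n + r ≠ 0) :
    (partialFractionCoeff (M + 1) (n + 1 + r) n : ℂ) =
      ((M + 1 : ℕ) : ℂ) * (-1) ^ n *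
        (∏ j ∈ range M, Complex.GammaSeq (1 - ζ ^ (j + 1) * ((n + 1 : ℕ) : ℂ)) (n + r)) /
          (n + 1)! *
        ((((n + r : ℕ) : ℂ) + 1) ^ M * ((n + 1 + r).descFactorial (n + 1)) /
          ((n + r : ℕ) : ℂ) ^ (M + (n + 1))) := by
  rw [prod_GammaSeq_one_sub_pow_succ_mul hM hζ n r hr, prod_div_distrib,
    prod_erase_range_natCast_sub, partialFractionCoeff]
  push_cast
  rw [prod_div_distrib, prod_pow]
  have h1 := prod_erase_range_succ n r (R := ℂ)
  have h2 : (r ! : ℂ) * (n + 1 + r).descFactorial (n + 1) = (n + 1 + r)! := by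
    have := factorial_mul_descFactorial (n := n + 1 + r) (k := n + 1) (by omega)
    rw [show n + 1 + r - (n + 1) = r by omega] at this
    exact_mod_cast this
  have h3 : ((n + 1 + r)! : ℂ) = ((n : ℂ) + r + 1) * (n + r)! := by
    rw [show n + 1 + r = n + r + 1 by ring, factorial_succ]
    push_cast
    ring
  have h4 : ((n + 1)! : ℂ) = ((n : ℂ) + 1) * n ! := by
    rw [factorial_succ]
    push_cast
    ring
  have hN : (n : ℂ) + r ≠ 0 := by exact_mod_cast hr
  have hn : (n : ℂ) + 1 ≠ 0 := by exact_mod_cast n.succ_ne_zero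
  have hM' : (M : ℂ) + 1 ≠ 0 := by exact_mod_cast M.succ_ne_zero
  have hP : ∏ k ∈ (range (n + 1 + r)).erase n,
      (((k : ℂ) + 1) ^ (M + 1) - ((n : ℂ) + 1) ^ (M + 1)) ≠ 0 := by
    refine prod_ne_zero_iff.2 fun k hk => sub_ne_zero.2 fun h => ne_of_mem_erase hk ?_
    exact succ_pow_injective M.succ_ne_zero (by exact_mod_cast h)
  have hfn : (n ! : ℂ) ≠ 0 := by exact_mod_cast n.factorial_ne_zero
  have hfr : (r ! : ℂ) ≠ 0 := by exact_mod_cast r.factorial_ne_zero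
  rw [h4]
  rw [mul_comm, ← eq_div_iff hn] at h1
  rw [mul_comm, ← eq_div_iff hfr] at h2
  rw [h1, h2, h3]
  generalize ∏ k ∈ (range (n + 1 + r)).erase n,
      (((k : ℂ) + 1) ^ (M + 1) - ((n : ℂ) + 1) ^ (M + 1)) = P at *
  have hs : ((-1 : ℂ) ^ n) * (-1) ^ n = 1 := by rw [← mul_pow]; simp
  have hs0 : ((-1 : ℂ) ^ n) ≠ 0 := by simp
  generalize (-1 : ℂ) ^ n = e at *
  generalize (n : ℂ) + r = N at *
  rw [div_pow, mul_pow]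
  field_simp
  linear_combination (-((N + 1) ^ (M + 1) * ((n + r)! : ℂ) ^ (M + 1) * (n + 1) ^ (M + 1))) * hs

/-! ### Passage to the limit -/

open Filter Topology in
theorem tendsto_succ_pow_mul_descFactorial_div (M q : ℕ) :
    Tendsto (fun N : ℕ => ((N : ℝ) + 1) ^ M * ((N + 1).descFactorial q) / (N : ℝ) ^ (M + q)) atTop
      (𝓝 1) := by
  have h1 : Tendsto (fun N : ℕ => ((N : ℝ) + 1) / N) atTop (𝓝 1) := by
    have h := tendsto_one_div_atTop_nhds_zero_nat (𝕜 := ℝ)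
    have h' := h.const_add 1
    rw [add_zero] at h'
    refine h'.congr' ?_
    filter_upwards [eventually_ne_atTop 0] with N hN
    have : (N : ℝ) ≠ 0 := by exact_mod_cast hN
    field_simp
  have hz : ∀ᶠ N : ℕ in atTop, (N : ℝ) ^ q ≠ 0 := by
    filter_upwards [eventually_ne_atTop 0] with N hN
    exact pow_ne_zero _ (by exact_mod_cast hN)
  have h2 := ((Asymptotics.isEquivalent_iff_tendsto_one hz).1
    (isEquivalent_descFactorial q)).comp (tendsto_add_atTop_nat 1)
  have h3 := (h1.pow (M + q)).mul h2
  rw [one_pow, one_mul] at h3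
  refine h3.congr' ?_
  filter_upwards [eventually_ne_atTop 0] with N hN
  have : (N : ℝ) ≠ 0 := by exact_mod_cast hN
  simp only [Function.comp, Pi.div_apply]
  push_cast
  have : (N : ℝ) + 1 ≠ 0 := by positivity
  rw [div_pow, pow_add _ M q]
  field_simp

open Filter Topology Finset Nat in
theorem tendsto_partialFractionCoeff {M : ℕ} (hM : M ≠ 0) {ζ : ℂ}
    (hζ : IsPrimitiveRoot ζ (M + 1)) (n : ℕ) :
    Tendsto (fun K => (partialFractionCoeff (M + 1) K n : ℂ)) atTop
      (𝓝 (((M + 1 : ℕ) : ℂ) * (-1) ^ n *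
        (∏ j ∈ range M, Complex.Gamma (1 - ζ ^ (j + 1) * ((n + 1 : ℕ) : ℂ))) / (n + 1)!)) := by
  rw [← tendsto_add_atTop_iff_nat 1]
  have h1 := tendsto_finsetProd (range M) fun j _ =>
    Complex.GammaSeq_tendsto_Gamma (1 - ζ ^ (j + 1) * ((n + 1 : ℕ) : ℂ))
  have h2 := (Complex.continuous_ofReal.tendsto 1).comp
    (tendsto_succ_pow_mul_descFactorial_div M (n + 1))
  have h3 := ((h1.const_mul (((M + 1 : ℕ) : ℂ) * (-1) ^ n)).div_const ((n + 1)! : ℂ)).mul h2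
  rw [Complex.ofReal_one, mul_one] at h3
  refine h3.congr' ?_
  filter_upwards [eventually_ge_atTop (n + 1)] with N hN
  obtain ⟨r, rfl⟩ : ∃ r, N = n + r := ⟨N - n, by omega⟩
  rw [show n + r + 1 = n + 1 + r by ring, partialFractionCoeff_eq_prod_GammaSeq hM hζ n r (by omega)]
  simp only [Function.comp]
  push_cast
  rw [show n + r + 1 = n + 1 + r by ring]

open Filter Topology Finset Nat in
theorem hasSum_prod_Gamma_div {M : ℕ} (hM : M ≠ 0) {ζ : ℂ} (hζ : IsPrimitiveRoot ζ (M + 1)) :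
    HasSum (fun n : ℕ => ((M + 1 : ℕ) : ℂ) * (-1) ^ n *
        (∏ j ∈ range M, Complex.Gamma (1 - ζ ^ (j + 1) * ((n + 1 : ℕ) : ℂ))) / (n + 1)! /
          ((n : ℂ) + 1) ^ (M + 1)) (riemannZeta ((M + 1 : ℕ) : ℂ)) := by
  set c : ℕ → ℂ := fun n => ((M + 1 : ℕ) : ℂ) * (-1) ^ n *
        (∏ j ∈ range M, Complex.Gamma (1 - ζ ^ (j + 1) * ((n + 1 : ℕ) : ℂ))) / (n + 1)! with hc
  change HasSum (fun n => c n / ((n : ℂ) + 1) ^ (M + 1)) _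
  have hsum1 : Summable fun n : ℕ => 1 / ((n : ℝ) + 1) ^ (M + 1) := by
    have := (summable_nat_add_iff 1).2
      (Real.summable_one_div_nat_pow (p := M + 1).2 (by omega))
    simpa using this
  have hbound : Summable fun n : ℕ => 2 / ((n : ℝ) + 1) ^ (M + 1) := by
    simpa [div_eq_mul_inv] using hsum1.mul_left 2
  have hnorm (n : ℕ) : ‖((n : ℂ) + 1) ^ (M + 1)‖ = ((n : ℝ) + 1) ^ (M + 1) := by
    rw [norm_pow]
    congr 1
    exact_mod_cast Complex.norm_natCast (n + 1)
  have hlim (n : ℕ) : Tendsto (fun K => (partialFractionCoeff (M + 1) K n : ℂ)) atTop (𝓝 (c n)) :=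
    tendsto_partialFractionCoeff hM hζ n
  have hle (n : ℕ) : ‖c n / ((n : ℂ) + 1) ^ (M + 1)‖ ≤ 2 / ((n : ℝ) + 1) ^ (M + 1) := by
    rw [norm_div, hnorm]
    gcongr
    -- The limit inherits the uniform bound `2`.
    refine le_of_tendsto (hlim n).norm ?_
    filter_upwards [eventually_gt_atTop n] with K hK
    rw [Complex.norm_real]
    exact abs_partialFractionCoeff_le (by omega) hK
  have hsummable : Summable fun n => c n / ((n : ℂ) + 1) ^ (M + 1) :=
    hbound.of_norm_bounded hle
  -- The finite sums are extended by zero for `n ≥ K`, where the bound on the coefficients is not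
  -- available.
  have hT := tendsto_tsum_of_dominated_convergence (𝓕 := atTop)
    (f := fun K n => if n < K then (partialFractionCoeff (M + 1) K n : ℂ) / ((n : ℂ) + 1) ^ (M + 1)
      else 0) (g := fun n => c n / ((n : ℂ) + 1) ^ (M + 1)) hbound
    (fun n => by
      refine ((hlim n).div_const _).congr' ?_
      filter_upwards [eventually_gt_atTop n] with K hK
      rw [if_pos hK])
    (Eventually.of_forall fun K n => by
      split_ifs with h
      · rw [norm_div, hnorm, Complex.norm_real]
        gcongr
        exact abs_partialFractionCoeff_le (by omega) h
      · rw [norm_zero]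
        positivity)
  have hfin (K : ℕ) : ∑' n, (if n < K then
      (partialFractionCoeff (M + 1) K n : ℂ) / ((n : ℂ) + 1) ^ (M + 1) else 0) =
        ∑ n ∈ range K, 1 / ((n : ℂ) + 1) ^ (M + 1) := by
    rw [tsum_eq_sum (s := range K) fun n hn => if_neg (by simpa using hn)]
    rw [sum_congr rfl fun n hn => if_pos (mem_range.1 hn)]
    have h := congrArg Complex.ofReal (sum_partialFractionCoeff_div (m := M + 1) (by omega) K)
    push_cast at h
    exact h
  simp only [hfin] at hT
  have hzsum : Summable fun n : ℕ => 1 / ((n : ℂ) + 1) ^ (M + 1) := by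
    refine hsum1.of_norm_bounded fun n => ?_
    rw [norm_div, hnorm, norm_one]
  have hzeta : riemannZeta ((M + 1 : ℕ) : ℂ) = ∑' n : ℕ, 1 / ((n : ℂ) + 1) ^ (M + 1) := by
    have hs0 : Summable fun n : ℕ => 1 / (n : ℂ) ^ (M + 1) := by
      rw [← summable_nat_add_iff 1]
      simpa using hzsum
    rw [zeta_nat_eq_tsum_of_gt_one (by omega), hs0.tsum_eq_zero_add]
    simp
  rw [hzeta, tendsto_nhds_unique hzsum.hasSum.tendsto_sum_nat hT]
  exact hsummable.hasSum

theorem theorem1 (m : ℕ) (hm : 2 ≤ m) :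
    HasSum
      (fun k : ℕ =>
        ((m : ℂ) * (-1 : ℂ) ^ ((k + 1) - 1) *
            ∏ j ∈ Finset.Icc 1 (m - 1),
              Complex.Gamma
                (1 - Complex.exp (2 * (Real.pi : ℂ) * Complex.I / (m : ℂ)) ^ j * ((k + 1 : ℕ) : ℂ)))
          / ((Nat.factorial (k + 1) : ℂ) * ((k + 1 : ℕ) : ℂ) ^ m))
      (riemannZeta (m : ℂ)) := by
  obtain ⟨M, rfl⟩ : ∃ M, m = M + 1 := ⟨m - 1, by omega⟩
  refine (hasSum_prod_Gamma_div (by omega)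
    (Complex.isPrimitiveRoot_exp (M + 1) M.succ_ne_zero)).congr_fun fun k => ?_
  rw [Finset.range_eq_Ico, Finset.prod_Ico_add' (fun j => Complex.Gamma
    (1 - Complex.exp (2 * (Real.pi : ℂ) * Complex.I / ((M + 1 : ℕ) : ℂ)) ^ j *
      ((k + 1 : ℕ) : ℂ))) 0 M 1, zero_add, Finset.Ico_add_one_right_eq_Icc, div_div]
  simp
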